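/- Let $\mathcal G=(B,\psi,A)$ be a finite quantum graph: $B$ is a finite-dimensional C*-algebra, $\psi$ is a (faithful) state on $B$ which is a $\delta$-form for some $\delta>0$, i.e. $mm^*=\delta^2\,\mathrm{id}_B$, where $m^*:B\to B\otimes B$ is the Hermitian adjoint of the multiplication $m: L^2(B\otimes B,\psi\otimes\psi)\to L^2(B,\psi)$, and $A:B\to B$ is a completely positive map with $m(A\otimes A)m^*=\delta^2A$. Put $\varepsilon_{\mathcal G}=\delta^{-2}(\mathrm{id}_B\otimes A)m^*(1_B)$, and let $E_{\mathcal G}=\mathrm{span}\{x\cdot\varepsilon_{\mathcal G}\cdot y: x,y\in B\}$ be the quantum edge correspondence, a sub-C*-correspondence of $B\otimes_\psi B$, whose operations are $a\cdot(x\otimes y)\cdot b=(ax)\otimes(yb)$ and $\langle x\otimes y\,|\,z\otimes w\rangle=\psi(x^*z)\,y^*w$. For a C*-correspondence $X$ over $B$ let $(\pi,t)$ be the universal covariant Toeplitz representation of $X$ in its Cuntz--Pimsner algebra $\mathcal O_X$, and let $t^k:X^{\otimes k}\to\mathcal O_X$ be given by $t^k(\xi_1\otimes\dots\otimes\xi_k)=t(\xi_1)\cdots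 t(\xi_k)$. A vector $\xi\in X^{\otimes m}$ is called non-returning if $t^m(\xi)^*\,t^n(\eta)\,t^m(\xi)=0$ whenever $0<n<m$ and $\eta\in X^{\otimes n}$. Let $1_c$ be a central projection in $B$ which is orthogonal to the range of $A$, i.e. $1_cA(x)=0$ for all $x\in B$. Then, for every $m\ge1$, \[ (1_c\cdot\varepsilon_{\mathcal G})\otimes\varepsilon_{\mathcal G}\otimes\varepsilon_{\mathcal G}\otimes\cdots\otimes\varepsilon_{\mathcal G}\in E_{\mathcal G}^{\otimes m} \] is a non-returning vector. -/

import Mathlib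

open scoped TensorProduct ComplexOrder ENNReal

universe u v

noncomputable section

/-! ## C*-correspondences over a finite-dimensional C*-algebra -/

/-- A finite-dimensional C*-correspondence over `B`: a finite-dimensional complex vector space with
a right `B`-action, a definite positive right `B`-valued inner product (conjugate linear in the
first variable, `B`-linear in the second) and a left action of `B` by adjointable operators, that is
a `*`-homomorphism from `B` to the adjointable operators. (Completeness is automatic in finite
dimension. Mathlib's `CStarModule` is not used: its axiom `⟪x, a • y⟫ = a * ⟪x, y⟫` is that of a
left module.) -/
structure Correspondence (B : Type u) [CStarAlgebra B] [PartialOrder B] [StarOrderedRing B] where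
  carrier : Type u
  [addCommGroup : AddCommGroup carrier]
  [module : Module ℂ carrier]
  [finiteDimensional : FiniteDimensional ℂ carrier]
  /-- the left action: `left b ξ` is `b · ξ` -/
  left : B →ₗ[ℂ] carrier →ₗ[ℂ] carrier
  /-- the right action: `right b ξ` is `ξ · b` -/
  right : B →ₗ[ℂ] carrier →ₗ[ℂ] carrier
  /-- the inner product `⟨ξ | η⟩` -/
  inner : carrier →ₗ⋆[ℂ] carrier →ₗ[ℂ] B
  left_mul : ∀ a b ξ, left (a * b) ξ = left a (left b ξ)
  right_mul : ∀ a b ξ, right (a * b) ξ = right b (right a ξ)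
  right_one : ∀ ξ, right 1 ξ = ξ
  inner_right : ∀ ξ η b, inner ξ (right b η) = inner ξ η * b
  star_inner : ∀ ξ η, star (inner ξ η) = inner η ξ
  inner_self_nonneg : ∀ ξ, 0 ≤ inner ξ ξ
  inner_self_eq_zero : ∀ ξ, inner ξ ξ = 0 → ξ = 0
  inner_left : ∀ b ξ η, inner (left b ξ) η = inner ξ (left (star b) η)

attribute [instance] Correspondence.addCommGroup Correspondence.module
  Correspondence.finiteDimensional

namespace Correspondence

variable {B : Type u} [CStarAlgebra B] [PartialOrder B] [StarOrderedRing B]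

instance : CoeSort (Correspondence B) (Type u) := ⟨Correspondence.carrier⟩

variable (X : Correspondence B)

/-- The rank-one operator `θ_{ξ,η} : μ ↦ ξ · ⟨η | μ⟩`. -/
def rankOne (ξ η : X) : X →ₗ[ℂ] X where
  toFun μ := X.right (X.inner η μ) ξ
  map_add' := by simp
  map_smul' := by simp

/-- The compact operators `K(X)`; as `X` is finite-dimensional, the span of the rank-one operators
is closed. -/
def compacts : Submodule ℂ (X →ₗ[ℂ] X) :=
  Submodule.span ℂ {T | ∃ ξ η : X, T = X.rankOne ξ η}

/-- The Katsura ideal `J_X = φ⁻¹(K(X)) ∩ (ker φ)^⊥`, where `φ` is the left action. -/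
def katsuraIdeal : Set B :=
  {b | X.left b ∈ X.compacts ∧ ∀ a, X.left a = 0 → a * b = 0}

/-! ### Toeplitz representations -/

/-- A Toeplitz representation `(π, t)` of `X` in a C*-algebra `D`. -/
structure ToeplitzRep (D : Type v) [NonUnitalCStarAlgebra D] where
  π : B →⋆ₙₐ[ℂ] D
  t : X →ₗ[ℂ] D
  left_covariant : ∀ b ξ, π b * t ξ = t (X.left b ξ)
  star_t_mul_t : ∀ ξ η, star (t ξ) * t η = π (X.inner ξ η)

namespace ToeplitzRep

variable {X} {D : Type v} [NonUnitalCStarAlgebra D] (r : X.ToeplitzRep D)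

theorem t_mul_π (ξ : X) (b : B) : r.t ξ * r.π b = r.t (X.right b ξ) := by
  rw [← sub_eq_zero, ← CStarRing.star_mul_self_eq_zero_iff]
  have h1 : X.inner (X.right b ξ) ξ = star b * X.inner ξ ξ := by
    rw [← X.star_inner, X.inner_right, star_mul, X.star_inner]
  have h2 : star (r.t ξ) * (r.t ξ * r.π b) = r.π (X.inner ξ ξ * b) := by
    rw [← mul_assoc, r.star_t_mul_t, map_mul]
  simp only [star_sub, star_mul, sub_mul, mul_sub, mul_assoc, h2, r.star_t_mul_t, X.inner_right]
  rw [← mul_assoc (star (r.t _)), r.star_t_mul_t, h1, ← map_star]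
  simp [mul_assoc]

theorem norm_t_sq_le (ξ : X) : ‖r.t ξ‖ ^ 2 ≤ ‖X.inner ξ ξ‖ := by
  rw [sq, ← CStarRing.norm_star_mul_self, r.star_t_mul_t]
  exact NonUnitalStarAlgHom.norm_apply_le r.π _

/-- The assignment `θ_{ξ,η} ↦ t(ξ) t(η)*` extends to a well-defined linear map `ψ_t` on `K(X)`. -/
theorem sum_t_mul_star_t_eq_zero {n : ℕ} (ξ η : Fin n → X)
    (h : ∑ i, X.rankOne (ξ i) (η i) = 0) : ∑ i, r.t (ξ i) * star (r.t (η i)) = 0 := by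
  rw [← CStarRing.mul_star_self_eq_zero_iff]
  have key : ∀ μ : X, (∑ i, r.t (ξ i) * star (r.t (η i))) * r.t μ = 0 := by
    intro μ
    simp only [Finset.sum_mul, mul_assoc, r.star_t_mul_t, r.t_mul_π]
    rw [← map_sum]
    have := congrArg (fun T : X →ₗ[ℂ] X => T μ) h
    simp only [LinearMap.sum_apply, LinearMap.zero_apply] at this
    exact (congrArg r.t this).trans (map_zero _)
  rw [star_sum, Finset.mul_sum]
  refine Finset.sum_eq_zero fun i _ => ?_
  rw [star_mul, star_star, ← mul_assoc, key, zero_mul]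

/-- `(π, t)` is covariant: `π(b) = ψ_t(φ(b))` for all `b ∈ J_X`, where `ψ_t` is the map on `K(X)`
with `ψ_t (∑ θ_{ξᵢ,ηᵢ}) = ∑ t(ξᵢ) t(ηᵢ)*`. -/
def IsCovariant : Prop :=
  ∀ b ∈ X.katsuraIdeal, ∀ (n : ℕ) (ξ η : Fin n → X),
    X.left b = ∑ i, X.rankOne (ξ i) (η i) → r.π b = ∑ i, r.t (ξ i) * star (r.t (η i))

end ToeplitzRep

/-! ### The Cuntz--Pimsner algebra -/

/-- A covariant Toeplitz representation of `X` in some C*-algebra. (The C*-algebra generated by the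
images of `B` and `X` always has a copy in the universe of `B` and `X`.) -/
structure CovariantRep where
  D : Type u
  [cstar : NonUnitalCStarAlgebra D]
  rep : X.ToeplitzRep D
  covariant : rep.IsCovariant

attribute [instance] CovariantRep.cstar

/-- The C*-algebra of bounded families indexed by all covariant representations. -/
abbrev BoundedFamilies : Type (u + 1) := lp (fun r : X.CovariantRep => r.D) ∞

/-- The direct sum of all covariant representations, on `B`. -/
def sumπ : B →⋆ₙₐ[ℂ] X.BoundedFamilies where
  toFun b := ⟨fun r => r.rep.π b, memℓp_infty ⟨‖b‖, by
    rintro _ ⟨r, rfl⟩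
    exact NonUnitalStarAlgHom.norm_apply_le r.rep.π b⟩⟩
  map_smul' c b := by ext r; exact map_smul r.rep.π c b
  map_zero' := by ext r; exact map_zero r.rep.π
  map_add' a b := by ext r; exact map_add r.rep.π a b
  map_mul' a b := by ext r; exact map_mul r.rep.π a b
  map_star' b := by ext r; exact map_star r.rep.π b

/-- The direct sum of all covariant representations, on `X`. -/
def sumt : X →ₗ[ℂ] X.BoundedFamilies where
  toFun ξ := ⟨fun r => r.rep.t ξ, memℓp_infty ⟨√‖X.inner ξ ξ‖, by
    rintro _ ⟨r, rfl⟩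
    exact Real.le_sqrt_of_sq_le (r.rep.norm_t_sq_le ξ)⟩⟩
  map_smul' c b := by ext r; exact map_smul r.rep.t c b
  map_add' a b := by ext r; exact map_add r.rep.t a b

/-- The Cuntz--Pimsner algebra `O_X`: the C*-algebra generated by the direct sum of all covariant
representations of `X`. -/
def cuntzPimsner : NonUnitalStarSubalgebra ℂ X.BoundedFamilies :=
  (NonUnitalStarAlgebra.adjoin ℂ
    (Set.range X.sumπ ∪ Set.range X.sumt)).topologicalClosure

instance : NonUnitalCStarAlgebra X.cuntzPimsner :=
  NonUnitalStarSubalgebra.nonUnitalCStarAlgebra X.cuntzPimsner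
    (h_closed := NonUnitalStarSubalgebra.isClosed_topologicalClosure _)

/-- The universal covariant representation `(π_X, t_X)` of `X` in `O_X`. -/
def universalRep : X.ToeplitzRep X.cuntzPimsner where
  π := NonUnitalStarAlgHom.codRestrict X.sumπ X.cuntzPimsner fun b =>
    NonUnitalStarSubalgebra.le_topologicalClosure _
      (NonUnitalStarAlgebra.subset_adjoin ℂ _ (Or.inl ⟨b, rfl⟩))
  t :=
    { toFun := fun ξ => ⟨X.sumt ξ, NonUnitalStarSubalgebra.le_topologicalClosure _
        (NonUnitalStarAlgebra.subset_adjoin ℂ _ (Or.inr ⟨ξ, rfl⟩))⟩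
      map_add' := fun ξ η => Subtype.ext (map_add X.sumt ξ η)
      map_smul' := fun c ξ => Subtype.ext (map_smul X.sumt c ξ) }
  left_covariant b ξ := by
    apply Subtype.ext; ext r; exact r.rep.left_covariant b ξ
  star_t_mul_t ξ η := by
    apply Subtype.ext; ext r; exact r.rep.star_t_mul_t ξ η

theorem universalRep_isCovariant : X.universalRep.IsCovariant := by
  intro b hb n ξ η h
  apply Subtype.ext
  ext r
  have := r.covariant b hb n ξ η h
  have e : ((∑ i, X.universalRep.t (ξ i) * star (X.universalRep.t (η i)) :
      X.cuntzPimsner) : X.BoundedFamilies) r =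
      ∑ i, r.rep.t (ξ i) * star (r.rep.t (η i)) := by
    rw [AddSubmonoidClass.coe_finsetSum, lp.coeFn_sum, Finset.sum_apply]
    rfl
  rw [e]
  exact this

/-- Universality: each covariant representation factors through `(π_X, t_X)`. -/
theorem exists_hom_of_isCovariant {D : Type u} [NonUnitalCStarAlgebra D] (r : X.ToeplitzRep D)
    (hr : r.IsCovariant) : ∃ ρ : X.cuntzPimsner →⋆ₙₐ[ℂ] D,
      (∀ b, ρ (X.universalRep.π b) = r.π b) ∧ ∀ ξ, ρ (X.universalRep.t ξ) = r.t ξ :=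
  let i : X.CovariantRep := ⟨D, r, hr⟩
  ⟨{ toFun := fun a => (a : X.BoundedFamilies) i
     map_smul' := fun _ _ => rfl
     map_zero' := rfl
     map_add' := fun _ _ => rfl
     map_mul' := fun _ _ => rfl
     map_star' := fun _ => rfl }, fun _ => rfl, fun _ => rfl⟩

/-! ### Tensor powers and non-returning vectors -/

/-- A complex vector space with a left action of `B`. -/
structure LeftModule (B : Type u) [CStarAlgebra B] where
  carrier : Type u
  [addCommGroup : AddCommGroup carrier]
  [module : Module ℂ carrier]
  act : B →ₗ[ℂ] carrier →ₗ[ℂ] carrier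
  act_mul : ∀ a b ξ, act (a * b) ξ = act a (act b ξ)

attribute [instance] LeftModule.addCommGroup LeftModule.module

instance : CoeSort (LeftModule B) (Type u) := ⟨LeftModule.carrier⟩

/-- The relations `(x · b) ⊗ y = x ⊗ (b · y)` of the balanced tensor product. -/
def balancedRel (Y : LeftModule B) : Submodule ℂ (X ⊗[ℂ] Y) :=
  Submodule.span ℂ {z | ∃ (x : X) (b : B) (y : Y),
    z = X.right b x ⊗ₜ[ℂ] y - x ⊗ₜ[ℂ] Y.act b y}

theorem left_right (a b : B) (ξ : X) : X.left a (X.right b ξ) = X.right b (X.left a ξ) := by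
  rw [← sub_eq_zero]
  apply X.inner_self_eq_zero
  have h : ∀ η, X.inner η (X.left a (X.right b ξ)) = X.inner η (X.right b (X.left a ξ)) := by
    intro η
    have h1 := X.inner_left (star a) η (X.right b ξ)
    have h2 := X.inner_left (star a) η ξ
    rw [star_star] at h1 h2
    rw [← h1, X.inner_right, X.inner_right, h2]
  rw [map_sub, sub_eq_zero]
  exact h _

theorem balancedRel_le_comap (Y : LeftModule B) (b : B) :
    X.balancedRel Y ≤ (X.balancedRel Y).comap ((X.left b).rTensor Y) := by
  refine Submodule.span_le.2 ?_
  rintro _ ⟨x, a, y, rfl⟩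
  refine Submodule.subset_span ⟨X.left b x, a, y, ?_⟩
  simp [X.left_right]

/-- The action `b · (x ⊗ y) = (b · x) ⊗ y` on the balanced tensor product. -/
def tensorAct (Y : LeftModule B) :
    B →ₗ[ℂ] ((X ⊗[ℂ] Y) ⧸ X.balancedRel Y) →ₗ[ℂ] ((X ⊗[ℂ] Y) ⧸ X.balancedRel Y) where
  toFun b := (X.balancedRel Y).mapQ (X.balancedRel Y) ((X.left b).rTensor Y)
    (X.balancedRel_le_comap Y b)
  map_add' a b := by
    apply Submodule.linearMap_qext
    ext x y
    simp
  map_smul' c b := by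
    apply Submodule.linearMap_qext
    ext x y
    simp

/-- The balanced tensor product `X ⊗_B Y` with the left action on the first factor. (In finite
dimension the canonical `B`-valued form on the balanced tensor product of two correspondences is
definite and complete, so this is the underlying space of the tensor product of
C*-correspondences.) -/
def tensor (Y : LeftModule B) : LeftModule B where
  carrier := (X ⊗[ℂ] Y) ⧸ X.balancedRel Y
  act := X.tensorAct Y
  act_mul a b ξ := by
    have h : X.left (a * b) = X.left a ∘ₗ X.left b := LinearMap.ext (X.left_mul a b)
    obtain ⟨z, rfl⟩ := Submodule.Quotient.mk_surjective _ ξ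
    simp [tensorAct, h, ← LinearMap.rTensor_comp_apply]

/-- The elementary tensor `x ⊗ y` in `X ⊗_B Y`. -/
def tmul {Y : LeftModule B} (x : X) (y : Y) : X.tensor Y :=
  Submodule.Quotient.mk (p := X.balancedRel Y) (x ⊗ₜ[ℂ] y)

/-- The tensor powers `X^{⊗0} = B`, `X^{⊗1} = X`, `X^{⊗(n+1)} = X ⊗_B X^{⊗n}`. -/
def tensorPow : ℕ → LeftModule B
  | 0 => { carrier := B, act := LinearMap.mul ℂ B, act_mul := fun a b c => mul_assoc a b c }
  | 1 => { carrier := X, act := X.left, act_mul := X.left_mul }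
  | n + 2 => X.tensor (tensorPow (n + 1))

/-- The elementary tensor `ξ₀ ⊗ ⋯ ⊗ ξₙ` in `X^{⊗(n+1)}`. -/
def elementary : (n : ℕ) → (Fin (n + 1) → X) → X.tensorPow (n + 1)
  | 0, ξ => ξ 0
  | n + 1, ξ => X.tmul (ξ 0) (elementary n (Fin.tail ξ))

namespace ToeplitzRep

variable {X} {D : Type v} [NonUnitalCStarAlgebra D] (r : X.ToeplitzRep D)

/-- For `f : Y → D` compatible with the left action, the map `x ⊗ y ↦ t(x) f(y)` on `X ⊗_B Y`. -/
def tensorLift {Y : LeftModule B} (f : Y →ₗ[ℂ] D) (hf : ∀ b y, f (Y.act b y) = r.π b * f y) :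
    X.tensor Y →ₗ[ℂ] D :=
  (X.balancedRel Y).liftQ (TensorProduct.lift ((LinearMap.mul ℂ D).compl₁₂ r.t f)) <| by
    refine Submodule.span_le.2 ?_
    rintro _ ⟨x, b, y, rfl⟩
    simp [hf, ← r.t_mul_π, mul_assoc]

theorem tensorLift_act {Y : LeftModule B} (f : Y →ₗ[ℂ] D)
    (hf : ∀ b y, f (Y.act b y) = r.π b * f y) (b : B) (ξ : X.tensor Y) :
    r.tensorLift f hf ((X.tensor Y).act b ξ) = r.π b * r.tensorLift f hf ξ := by
  have h : (r.tensorLift f hf : ((X ⊗[ℂ] Y) ⧸ X.balancedRel Y) →ₗ[ℂ] D) ∘ₗ X.tensorAct Y b =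
      LinearMap.mulLeft ℂ (r.π b) ∘ₗ r.tensorLift f hf := by
    apply Submodule.linearMap_qext
    ext x y
    change r.t (X.left b x) * f y = r.π b * (r.t x * f y)
    rw [← r.left_covariant, mul_assoc]
  exact LinearMap.congr_fun h ξ

/-- The maps `t^n : X^{⊗n} → D`, with the fact that they respect the left action. -/
def tPowAux : (n : ℕ) →
    {f : X.tensorPow n →ₗ[ℂ] D // ∀ b ξ, f ((X.tensorPow n).act b ξ) = r.π b * f ξ}
  | 0 => ⟨(r.π : B →ₗ[ℂ] D), fun a b => map_mul r.π a b⟩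
  | 1 => ⟨r.t, fun b ξ => (r.left_covariant b ξ).symm⟩
  | n + 2 => ⟨r.tensorLift (tPowAux (n + 1)).1 (tPowAux (n + 1)).2,
      r.tensorLift_act (tPowAux (n + 1)).1 (tPowAux (n + 1)).2⟩

/-- The map `t^n : X^{⊗n} → D`: `t^0 = π`, `t^1 = t` and `t^(n+1)(x ⊗ ξ) = t(x) t^n(ξ)`. -/
def tPow (n : ℕ) : X.tensorPow n →ₗ[ℂ] D := (r.tPowAux n).1

end ToeplitzRep

/-- A vector `ξ ∈ X^{⊗m}` is non-returning if `t^m(ξ)* t^n(η) t^m(ξ) = 0` in `O_X` for all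
`0 < n < m` and all `η ∈ X^{⊗n}`, where `(π, t)` is the universal covariant representation. -/
def IsNonReturning {m : ℕ} (ξ : X.tensorPow m) : Prop :=
  ∀ n, 0 < n → n < m → ∀ η : X.tensorPow n,
    star (X.universalRep.tPow m ξ) * X.universalRep.tPow n η * X.universalRep.tPow m ξ = 0

end Correspondence

/-! ## Quantum graphs -/

section QuantumGraph

variable {B : Type u} [CStarAlgebra B] [PartialOrder B] [StarOrderedRing B]

/-- A faithful state on `B`. -/
structure FaithfulState (B : Type u) [CStarAlgebra B] [PartialOrder B] where
  toMap : B →ₚ[ℂ] ℂ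
  map_one : toMap 1 = 1
  faithful : ∀ x, toMap (star x * x) = 0 → x = 0

namespace FaithfulState

/-- The space `L²(B, ψ)`: the vector space `B` with the inner product `⟨x, y⟩ = ψ(x* y)`. -/
def L2 (ψ : FaithfulState B) : Type u := B

variable (ψ : FaithfulState B)

instance : AddCommGroup ψ.L2 := inferInstanceAs (AddCommGroup B)
instance : Module ℂ ψ.L2 := inferInstanceAs (Module ℂ B)
instance [FiniteDimensional ℂ B] : FiniteDimensional ℂ ψ.L2 :=
  inferInstanceAs (FiniteDimensional ℂ B)

/-- The identity map from `B` to `L²(B, ψ)`. -/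
def toL2 : B ≃ₗ[ℂ] ψ.L2 := LinearEquiv.refl ℂ B

/-- The inner product `⟨x, y⟩ = ψ(x* y)`. -/
abbrev innerCore : InnerProductSpace.Core ℂ ψ.L2 where
  inner x y := ψ.toMap (star (ψ.toL2.symm x) * ψ.toL2.symm y)
  conj_inner_symm := by simp [← Complex.star_def, ← map_star ψ.toMap]
  re_inner_nonneg _ :=
    (RCLike.nonneg_iff.mp (ψ.toMap.map_nonneg (star_mul_self_nonneg _))).1
  add_left _ _ _ := by rw [map_add, star_add, add_mul, map_add]
  smul_left := by simp
  definite x h := by simpa using ψ.faithful _ h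

instance : NormedAddCommGroup ψ.L2 := ψ.innerCore.toNormedAddCommGroup
instance : InnerProductSpace ℂ ψ.L2 := InnerProductSpace.ofCore ψ.innerCore.toCore

theorem inner_L2 (x y : B) : inner ℂ (ψ.toL2 x) (ψ.toL2 y) = ψ.toMap (star x * y) := rfl

/-- The multiplication `m : L²(B ⊗ B, ψ ⊗ ψ) → L²(B, ψ)`. -/
def mulL2 : ψ.L2 ⊗[ℂ] ψ.L2 →ₗ[ℂ] ψ.L2 :=
  ψ.toL2.toLinearMap ∘ₗ LinearMap.mul' ℂ B ∘ₗ
    TensorProduct.map ψ.toL2.symm.toLinearMap ψ.toL2.symm.toLinearMap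

/-- The Hermitian adjoint `m*`, as a map `B → B ⊗ B`. -/
def mulAdjoint [FiniteDimensional ℂ B] : B →ₗ[ℂ] B ⊗[ℂ] B :=
  TensorProduct.map ψ.toL2.symm.toLinearMap ψ.toL2.symm.toLinearMap ∘ₗ
    LinearMap.adjoint ψ.mulL2 ∘ₗ ψ.toL2.toLinearMap

/-! ### The correspondence `B ⊗_ψ B` -/

/-- The map `ψ ⊗ id : B ⊗ B → B`. -/
def slice : B ⊗[ℂ] B →ₗ[ℂ] B :=
  (TensorProduct.lid ℂ B).toLinearMap ∘ₗ (ψ.toMap.toLinearMap).rTensor B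

/-- The `B`-valued inner product of `B ⊗_ψ B`, namely `⟨u | v⟩ = (ψ ⊗ id)(u* v)`, that is
`⟨x ⊗ y | z ⊗ w⟩ = ψ(x* z) y* w`. -/
def innerB : B ⊗[ℂ] B →ₗ⋆[ℂ] B ⊗[ℂ] B →ₗ[ℂ] B where
  toFun u := ψ.slice ∘ₗ LinearMap.mulLeft ℂ (star u)
  map_add' u v := by ext; simp [add_mul]
  map_smul' c u := by ext; simp

theorem innerB_tmul (x y z w : B) :
    ψ.innerB (x ⊗ₜ y) (z ⊗ₜ w) = ψ.toMap (star x * z) • (star y * w) := by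
  simp [innerB, slice]

theorem star_innerB (u v : B ⊗[ℂ] B) : star (ψ.innerB u v) = ψ.innerB v u := by
  induction u using TensorProduct.induction_on with
  | zero => simp
  | add a b ha hb => simp [ha, hb]
  | tmul x y =>
    induction v using TensorProduct.induction_on with
    | zero => simp
    | add a b ha hb => simp [ha, hb]
    | tmul z w =>
      rw [innerB_tmul, innerB_tmul, star_smul, ← map_star ψ.toMap]
      simp

theorem innerB_self [FiniteDimensional ℂ B] (u : B ⊗[ℂ] B) :
    0 ≤ ψ.innerB u u ∧ (ψ.innerB u u = 0 → u = 0) := by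
  let e := stdOrthonormalBasis ℂ ψ.L2
  have hu : ∃ y : Fin (Module.finrank ℂ ψ.L2) → B, u = ∑ i, ψ.toL2.symm (e i) ⊗ₜ[ℂ] y i := by
    induction u using TensorProduct.induction_on with
    | zero => exact ⟨0, by simp⟩
    | add a b ha hb =>
      obtain ⟨y, rfl⟩ := ha
      obtain ⟨z, rfl⟩ := hb
      exact ⟨y + z, by simp [TensorProduct.tmul_add, Finset.sum_add_distrib]⟩
    | tmul x y =>
      refine ⟨fun i => e.repr (ψ.toL2 x) i • y, ?_⟩
      have : x = ψ.toL2.symm (∑ i, e.repr (ψ.toL2 x) i • e i) := by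
        rw [e.sum_repr]; simp
      conv_lhs => rw [this]
      simp only [map_sum, map_smul, TensorProduct.sum_tmul, TensorProduct.smul_tmul]
  obtain ⟨y, rfl⟩ := hu
  have key : ψ.innerB (∑ i, ψ.toL2.symm (e i) ⊗ₜ[ℂ] y i) (∑ i, ψ.toL2.symm (e i) ⊗ₜ[ℂ] y i) =
      ∑ i, star (y i) * y i := by
    have h : ∀ i j, ψ.toMap (star (ψ.toL2.symm (e i)) * ψ.toL2.symm (e j)) =
        if i = j then 1 else 0 := fun i j => by
      rw [← orthonormal_iff_ite.1 e.orthonormal i j]; rfl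
    simp [innerB_tmul, h]
  rw [key]
  have hn : ∀ i, 0 ≤ star (y i) * y i := fun i => star_mul_self_nonneg _
  refine ⟨Finset.sum_nonneg fun i _ => hn i, fun h0 => ?_⟩
  have := (Finset.sum_eq_zero_iff_of_nonneg fun i _ => hn i).1 h0
  refine Finset.sum_eq_zero fun i hi => ?_
  rw [(CStarRing.star_mul_self_eq_zero_iff _).1 (this i hi), TensorProduct.tmul_zero]

/-- The correspondence `B ⊗_ψ B`, with `a · (x ⊗ y) = (a x) ⊗ y`, `(x ⊗ y) · b = x ⊗ (y b)` and
`⟨x ⊗ y | z ⊗ w⟩ = ψ(x* z) y* w`. -/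
def tensorCorrespondence [FiniteDimensional ℂ B] : Correspondence B where
  carrier := B ⊗[ℂ] B
  left := LinearMap.rTensorHom B ∘ₗ LinearMap.mul ℂ B
  right := LinearMap.lTensorHom B ∘ₗ (LinearMap.mul ℂ B).flip
  inner := ψ.innerB
  left_mul a b ξ := by
    induction ξ using TensorProduct.induction_on with
    | zero => simp
    | add u v hu hv => simp only [map_add, hu, hv]
    | tmul x y => simp [mul_assoc]
  right_mul a b ξ := by
    induction ξ using TensorProduct.induction_on with
    | zero => simp
    | add u v hu hv => simp only [map_add, hu, hv]
    | tmul x y => simp [mul_assoc]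
  right_one ξ := by
    induction ξ using TensorProduct.induction_on with
    | zero => simp
    | add u v hu hv => simp only [map_add, hu, hv]
    | tmul x y => simp
  inner_right ξ η b := by
    induction ξ using TensorProduct.induction_on with
    | zero => simp
    | add u v hu hv => simp only [map_add, LinearMap.add_apply, hu, hv, add_mul]
    | tmul x y =>
      induction η using TensorProduct.induction_on with
      | zero => simp
      | add u v hu hv => simp only [map_add, hu, hv, add_mul]
      | tmul z w => simp [innerB_tmul, mul_assoc]
  star_inner := ψ.star_innerB
  inner_self_nonneg u := (ψ.innerB_self u).1
  inner_self_eq_zero u := (ψ.innerB_self u).2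
  inner_left b ξ η := by
    induction ξ using TensorProduct.induction_on with
    | zero => simp
    | add u v hu hv => simp only [map_add, LinearMap.add_apply, hu, hv]
    | tmul x y =>
      induction η using TensorProduct.induction_on with
      | zero => simp
      | add u v hu hv => simp only [map_add, hu, hv]
      | tmul z w => simp [innerB_tmul, mul_assoc]

end FaithfulState

namespace Correspondence

/-- The subcorrespondence of `X` on a subspace invariant under both actions, with the inherited
actions and inner product. -/
def sub (X : Correspondence B) (S : Submodule ℂ X) (hl : ∀ b, ∀ ξ ∈ S, X.left b ξ ∈ S)
    (hr : ∀ b, ∀ ξ ∈ S, X.right b ξ ∈ S) : Correspondence B where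
  carrier := S
  left :=
    { toFun := fun b => (X.left b).restrict (hl b)
      map_add' := fun a b => by ext; simp
      map_smul' := fun c b => by ext; simp }
  right :=
    { toFun := fun b => (X.right b).restrict (hr b)
      map_add' := fun a b => by ext; simp
      map_smul' := fun c b => by ext; simp }
  inner := (X.inner.compl₂ S.subtype).comp S.subtype
  left_mul a b ξ := Subtype.ext (X.left_mul a b ξ)
  right_mul a b ξ := Subtype.ext (X.right_mul a b ξ)
  right_one ξ := Subtype.ext (X.right_one ξ)
  inner_right ξ η b := X.inner_right ξ η b
  star_inner ξ η := X.star_inner ξ η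
  inner_self_nonneg ξ := X.inner_self_nonneg ξ
  inner_self_eq_zero ξ h := Subtype.ext (X.inner_self_eq_zero ξ h)
  inner_left b ξ η := X.inner_left b ξ η

/-- The `B`-`B`-subcorrespondence `span {x · ζ · y : x, y ∈ B}` generated by a vector `ζ`. -/
def cyclic (X : Correspondence B) (ζ : X) : Correspondence B :=
  X.sub (Submodule.span ℂ {ξ | ∃ x y : B, ξ = X.right y (X.left x ζ)})
    (fun b ξ hξ => by
      induction hξ using Submodule.span_induction with
      | mem ξ h =>
        obtain ⟨x, y, rfl⟩ := h
        exact Submodule.subset_span ⟨b * x, y, by rw [X.left_mul, X.left_right]⟩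
      | zero => simp
      | add u v _ _ hu hv => rw [map_add]; exact Submodule.add_mem _ hu hv
      | smul c u _ hu => rw [map_smul]; exact Submodule.smul_mem _ c hu)
    (fun b ξ hξ => by
      induction hξ using Submodule.span_induction with
      | mem ξ h =>
        obtain ⟨x, y, rfl⟩ := h
        exact Submodule.subset_span ⟨x, y * b, by rw [X.right_mul]⟩
      | zero => simp
      | add u v _ _ hu hv => rw [map_add]; exact Submodule.add_mem _ hu hv
      | smul c u _ hu => rw [map_smul]; exact Submodule.smul_mem _ c hu)

end Correspondence

/-- A finite quantum graph `(B, ψ, A)`: a state `ψ` on the finite-dimensional C*-algebra `B` which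
is a `δ`-form, i.e. `m m* = δ² id`, and a completely positive map `A : B → B` which is quantum Schur
idempotent, i.e. `m (A ⊗ A) m* = δ² A`. -/
structure QuantumGraph (B : Type u) [CStarAlgebra B] [PartialOrder B] [StarOrderedRing B]
    [FiniteDimensional ℂ B] where
  ψ : FaithfulState B
  δ : ℝ
  δ_pos : 0 < δ
  isDeltaForm : LinearMap.mul' ℂ B ∘ₗ ψ.mulAdjoint = ((δ : ℂ) ^ 2) • LinearMap.id
  A : CompletelyPositiveMap B B
  isSchurIdempotent : LinearMap.mul' ℂ B ∘ₗ
    TensorProduct.map A.toLinearMap A.toLinearMap ∘ₗ ψ.mulAdjoint = ((δ : ℂ) ^ 2) • A.toLinearMap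

namespace QuantumGraph

variable [FiniteDimensional ℂ B] (G : QuantumGraph B)

/-- The element `ε = δ⁻² (id ⊗ A) m*(1)` of `B ⊗ B`. -/
def edgeTensor : B ⊗[ℂ] B :=
  ((G.δ : ℂ) ^ 2)⁻¹ • (G.A.toLinearMap).lTensor B (G.ψ.mulAdjoint 1)

/-- The quantum edge correspondence `E = span {x · ε · y : x, y ∈ B}` inside `B ⊗_ψ B`. -/
def edgeCorrespondence : Correspondence B :=
  G.ψ.tensorCorrespondence.cyclic G.edgeTensor

/-- The vector `ε`, as an element of the quantum edge correspondence. -/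
def edgeVector : G.edgeCorrespondence :=
  ⟨G.edgeTensor, Submodule.subset_span ⟨1, 1, by
    rw [Correspondence.right_one]
    change G.edgeTensor = (LinearMap.mul ℂ B 1).rTensor B G.edgeTensor
    rw [show LinearMap.mul ℂ B 1 = LinearMap.id from by ext; simp, LinearMap.rTensor_id,
      LinearMap.id_apply]⟩⟩

end QuantumGraph

end QuantumGraph

end

/-!
In the left slot `c` acts on `E^{⊗m}`, in the right slot it kills `E`: a vector of `E` is a
combination of `x · ε · y`, whose right leg lies in `A(B) y`, and `A(B) y c = A(B) c y = 0`. Hence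
`t(ζ) π(c) = t(ζ · c) = 0` for all `ζ ∈ E`, so that already
`t^n(η) t^m(c · ξ) = t^n(η) π(c) t^m(ξ) = 0` for `n ≥ 1`.
-/

namespace Correspondence

variable {B : Type u} [CStarAlgebra B] [PartialOrder B] [StarOrderedRing B] {X : Correspondence B}

theorem cyclic_right_eq_zero {ζ : X} {b : B} (hb : ∀ a, Commute b a) (hζ : X.right b ζ = 0)
    (ξ : X.cyclic ζ) : (X.cyclic ζ).right b ξ = 0 := by
  have cyclic_le_ker :
      Submodule.span ℂ {ξ | ∃ x y : B, ξ = X.right y (X.left x ζ)} ≤ LinearMap.ker (X.right b) := by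
    refine Submodule.span_le.2 ?_
    rintro _ ⟨x, y, rfl⟩
    calc X.right b (X.right y (X.left x ζ))
      _ = X.right (b * y) (X.left x ζ) := by rw [← X.right_mul, (hb y).eq]
      _ = X.right y (X.left x (X.right b ζ)) := by rw [X.right_mul, X.left_right]
      _ = 0 := by rw [hζ, map_zero, map_zero]
  exact Subtype.ext (cyclic_le_ker ξ.2)

theorem act_elementary_cons (b : B) (ξ : X) (k : ℕ) (η : Fin k → X) :
    (X.tensorPow (k + 1)).act b (X.elementary k (Fin.cons ξ η)) =
      X.elementary k (Fin.cons (X.left b ξ) η) := by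
  cases k <;> rfl

namespace ToeplitzRep

variable {D : Type v} [NonUnitalCStarAlgebra D] (r : X.ToeplitzRep D)

theorem tPow_act (n : ℕ) (b : B) (ξ : X.tensorPow n) :
    r.tPow n ((X.tensorPow n).act b ξ) = r.π b * r.tPow n ξ :=
  (r.tPowAux n).2 b ξ

theorem tPow_tmul (n : ℕ) (x : X) (y : X.tensorPow (n + 1)) :
    r.tPow (n + 2) (X.tmul x y) = r.t x * r.tPow (n + 1) y :=
  rfl

theorem tPow_succ_mul_eq_zero {d : D} (hd : ∀ ξ, r.t ξ * d = 0) (n : ℕ)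
    (η : X.tensorPow (n + 1)) : r.tPow (n + 1) η * d = 0 := by
  induction n with
  | zero => exact hd η
  | succ n ih =>
    have mulRight_comp_tPow :
        (LinearMap.mulRight ℂ d ∘ₗ r.tPow (n + 2) :
          (X ⊗[ℂ] X.tensorPow (n + 1)) ⧸ X.balancedRel (X.tensorPow (n + 1)) →ₗ[ℂ] D) = 0 := by
      apply Submodule.linearMap_qext
      ext x y
      change r.tPow (n + 2) (X.tmul x y) * d = 0
      rw [tPow_tmul, mul_assoc, ih, mul_zero]
    exact LinearMap.congr_fun mulRight_comp_tPow η

theorem tPow_succ_mul_tPow_act_eq_zero {b : B} (hb : ∀ ζ, X.right b ζ = 0) (n m : ℕ)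
    (η : X.tensorPow (n + 1)) (ξ : X.tensorPow m) :
    r.tPow (n + 1) η * r.tPow m ((X.tensorPow m).act b ξ) = 0 := by
  have t_mul_π_eq_zero (ζ : X) : r.t ζ * r.π b = 0 := by rw [t_mul_π, hb, map_zero]
  rw [tPow_act, ← mul_assoc, r.tPow_succ_mul_eq_zero t_mul_π_eq_zero, zero_mul]

end ToeplitzRep

theorem isNonReturning_act {b : B} (hb : ∀ ζ, X.right b ζ = 0) {m : ℕ} (ξ : X.tensorPow m) :
    X.IsNonReturning ((X.tensorPow m).act b ξ) := by
  intro n hn _ η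
  obtain ⟨n, rfl⟩ := Nat.exists_eq_add_one.2 hn
  rw [mul_assoc, ToeplitzRep.tPow_succ_mul_tPow_act_eq_zero _ hb, mul_zero]

end Correspondence

section QuantumGraph

variable {B : Type u} [CStarAlgebra B] [PartialOrder B] [StarOrderedRing B]
  [FiniteDimensional ℂ B]

theorem FaithfulState.tensorCorrespondence_right_lTensor_eq_zero (ψ : FaithfulState B)
    {f : B →ₗ[ℂ] B} {b : B} (hf : ∀ x, f x * b = 0) (u : B ⊗[ℂ] B) :
    ψ.tensorCorrespondence.right b (f.lTensor B u) = 0 := by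
  have mul_comp : (LinearMap.mul ℂ B).flip b ∘ₗ f = 0 := LinearMap.ext hf
  change ((LinearMap.mul ℂ B).flip b).lTensor B (f.lTensor B u) = 0
  rw [← LinearMap.lTensor_comp_apply, mul_comp, LinearMap.lTensor_zero, LinearMap.zero_apply]

namespace QuantumGraph

variable (G : QuantumGraph B)

theorem right_edgeTensor_eq_zero {b : B} (hb : ∀ x, G.A x * b = 0) :
    G.ψ.tensorCorrespondence.right b G.edgeTensor = 0 :=
  (map_smul (G.ψ.tensorCorrespondence.right b) _ _).trans <| by
    rw [G.ψ.tensorCorrespondence_right_lTensor_eq_zero hb, smul_zero]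

theorem edgeCorrespondence_right_eq_zero {c : B} (hcentral : ∀ b, Commute c b)
    (horth : ∀ b, c * G.A b = 0) (ξ : G.edgeCorrespondence) :
    G.edgeCorrespondence.right c ξ = 0 := by
  have range_mul_eq_zero (b : B) : G.A b * c = 0 := by rw [← (hcentral _).eq, horth]
  exact Correspondence.cyclic_right_eq_zero hcentral
    (G.right_edgeTensor_eq_zero range_mul_eq_zero) ξ

end QuantumGraph

end QuantumGraph

theorem mainTheorem11_general {B : Type u} [CStarAlgebra B] [PartialOrder B] [StarOrderedRing B]
    [FiniteDimensional ℂ B] (G : QuantumGraph B) (c : B) (hcentral : ∀ b : B, c * b = b * c)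
    (horth : ∀ b : B, c * G.A b = 0) {m : ℕ} (ξ : G.edgeCorrespondence.tensorPow m) :
    G.edgeCorrespondence.IsNonReturning ((G.edgeCorrespondence.tensorPow m).act c ξ) :=
  Correspondence.isNonReturning_act (G.edgeCorrespondence_right_eq_zero hcentral horth) ξ

theorem mainTheorem11 {B : Type u} [CStarAlgebra B] [PartialOrder B] [StarOrderedRing B]
    [FiniteDimensional ℂ B] (G : QuantumGraph B) (c : B) (hc : IsStarProjection c)
    (hcentral : ∀ b : B, c * b = b * c) (horth : ∀ b : B, c * G.A b = 0) (k : ℕ) :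
    G.edgeCorrespondence.IsNonReturning (m := k + 1)
      (G.edgeCorrespondence.elementary k
        (Fin.cons (G.edgeCorrespondence.left c G.edgeVector) fun _ => G.edgeVector)) := by
  rw [← Correspondence.act_elementary_cons]
  exact mainTheorem11_general G c hcentral horth _
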